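/- Let $\mathcal S_{n,n}(\mathbb R)=\{U\in\mathbb R^{n\times n}: U^TU=I_n\}$. A measure $\mu$ on $\mathbb R^{p\times n}$ is left and right rotationally invariant if for all $Q\in\mathcal S_{p,p}(\mathbb R)$ and $R\in\mathcal S_{n,n}(\mathbb R)$ it is preserved by $X\mapsto QX$ and by $X\mapsto XR$. A random matrix is isotropically distributed on $\mathcal S_{n,n}(\mathbb R)$ if its law is a left and right rotationally invariant probability measure carried by $\mathcal S_{n,n}(\mathbb R)$ (the normalized Haar measure). A singular value decomposition (SVD) of $O\in\mathbb R^{p\times n}$ is a triple $(U,\Lambda,V)$ with $O=U\Lambda V^T$, $U\in\mathcal S_{p,p}(\mathbb R)$, $V\in\mathcal S_{n,n}(\mathbb R)$, and $\Lambda\in\mathbb R^{p\times n}$ rectangular diagonal with nonnegative, nonincreasing diagonal entries. As the SVD is not unique, it is chosen by a rule: a rotation-equivariant SVD rule is a Markov kernel $\kappa$ from $\mathbb R^{p\times n}$ to triples of matrices such that, for every $O$, $\kappa(O)$-almost every triple is an SVD of $O$, and for every $O$ and every $Q\in\mathcal S_{n,n}(\mathbb R)$ the law $\kappa(OQ)$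 is the image of $\kappa(O)$ under $(U,\Lambda,V)\mapsto(U,\Lambda,Q^TV)$. Lemma. Let $A\in\mathbb R^{n\times n}$ and $C\in\mathbb R^{d_y\times n}$ be independent random matrices, each with a left and right rotationally invariant law. Let $t_1,\dots,t_m\in\{0,1,2,\dots\}$ and let $$O_{\boldsymbol t}=\begin{bmatrix}CA^{t_1}\\ \vdots\\ CA^{t_m}\end{bmatrix}\in\mathbb R^{md_y\times n}.$$ Then rotation-equivariant SVD rules on $\mathbb R^{md_y\times n}$ exist. Moreover, for every such rule $\kappa$, if $O_{\boldsymbol t}=U_{\boldsymbol t}\Lambda_{\boldsymbol t}V_{\boldsymbol t}^T$ is the SVD of $O_{\boldsymbol t}$ chosen by $\kappa$ (that is, the conditional law of $(U_{\boldsymbol t},\Lambda_{\boldsymbol t},V_{\boldsymbol t})$ given $O_{\boldsymbol t}$ is $\kappa(O_{\boldsymbol t})$), then $V_{\boldsymbol t}$ is isotropically distributed on $\mathcal S_{n,n}(\mathbb R)$ and independent of the pair $(U_{\boldsymbol t},\Lambda_{\boldsymbol t})$. -/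

import Mathlib

open MeasureTheory ProbabilityTheory
open scoped Matrix

/-- The product (equivalently Borel) σ-algebra on real matrices. -/
instance instMeasurableSpaceRealMatrix {ι κ : Type*} : MeasurableSpace (Matrix ι κ ℝ) :=
  inferInstanceAs (MeasurableSpace (ι → κ → ℝ))

/-- The Stiefel manifold of `n × k` real matrices with orthonormal columns. -/
def stiefel (n k : ℕ) : Set (Matrix (Fin n) (Fin k) ℝ) := {U | Uᵀ * U = 1}

/-- Left and right rotational invariance of a measure on `m × n` real matrices. -/
def IsRotationInvariant {m n : ℕ} (μ : Measure (Matrix (Fin m) (Fin n) ℝ)) : Prop :=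
  (∀ Q ∈ stiefel m m, μ.map (fun X => Q * X) = μ) ∧
  (∀ Q ∈ stiefel n n, μ.map (fun X => X * Q) = μ)

/-- The isotropic distribution on the Stiefel manifold: a probability measure carried by the
Stiefel manifold and invariant under left and right rotations (for `n = k` this is the normalized
Haar measure of the orthogonal group). -/
structure IsIsotropic {n k : ℕ} (μ : Measure (Matrix (Fin n) (Fin k) ℝ)) : Prop where
  isProbabilityMeasure : IsProbabilityMeasure μ
  ae_mem : ∀ᵐ X ∂μ, X ∈ stiefel n k
  invariant : IsRotationInvariant μ

/-- The observation matrix: the blocks `C * A ^ t 0, …, C * A ^ t (m - 1)` on top of one another. -/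
def observationMatrix {n d m : ℕ} (A : Matrix (Fin n) (Fin n) ℝ) (C : Matrix (Fin d) (Fin n) ℝ)
    (t : Fin m → ℕ) : Matrix (Fin (m * d)) (Fin n) ℝ :=
  Matrix.of fun k j => (C * A ^ t (finProdFinEquiv.symm k).1) (finProdFinEquiv.symm k).2 j

/-- `O = U * Λ * Vᵀ` is a (full) singular value decomposition: `U` and `V` are orthogonal, and `Λ`
is rectangular diagonal with nonnegative, nonincreasing diagonal entries. -/
structure IsSVD {p n : ℕ} (O : Matrix (Fin p) (Fin n) ℝ) (U : Matrix (Fin p) (Fin p) ℝ)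
    (Λ : Matrix (Fin p) (Fin n) ℝ) (V : Matrix (Fin n) (Fin n) ℝ) : Prop where
  left_mem : U ∈ stiefel p p
  right_mem : V ∈ stiefel n n
  off_diag : ∀ (i : Fin p) (j : Fin n), (i : ℕ) ≠ (j : ℕ) → Λ i j = 0
  diag_nonneg : ∀ (i : Fin p) (j : Fin n), (i : ℕ) = (j : ℕ) → 0 ≤ Λ i j
  diag_antitone : ∀ (i : Fin p) (j : Fin n) (i' : Fin p) (j' : Fin n),
    (i : ℕ) = (j : ℕ) → (i' : ℕ) = (j' : ℕ) → i ≤ i' → Λ i' j' ≤ Λ i j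
  eq : O = U * Λ * Vᵀ

/-- A rule for choosing a singular value decomposition `(U, Λ, V)` of every `p × n` matrix.
Decompositions are not unique, so the choice may be random: `κ O` is the law of the decomposition
that is chosen for `O`. The choice does not depend on the orthonormal coordinate system of the
domain `ℝⁿ`: if `(U, Λ, V)` is the decomposition chosen for `O`, then the one chosen for `O * Q`
is distributed as `(U, Λ, Qᵀ * V)`. -/
structure IsRotationEquivariantSVD {p n : ℕ}
    (κ : Kernel (Matrix (Fin p) (Fin n) ℝ)
      (Matrix (Fin p) (Fin p) ℝ × Matrix (Fin p) (Fin n) ℝ × Matrix (Fin n) (Fin n) ℝ)) :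
    Prop where
  isMarkovKernel : IsMarkovKernel κ
  ae_isSVD : ∀ O, ∀ᵐ s ∂κ O, IsSVD O s.1 s.2.1 s.2.2
  equivariant : ∀ O, ∀ Q ∈ stiefel n n,
    κ (O * Q) = (κ O).map (fun s => (s.1, s.2.1, Qᵀ * s.2.2))

/-!
The two claims rest on separate ideas.

*Independence and isotropy.* For orthogonal `Q`, the pair `(Qᵀ A Q, C Q)` has the same law as
`(A, C)`, and its observation matrix is `O Q` (`observationMatrix_conj`). So the law of `O` is
invariant under `O ↦ O Q`, and by equivariance of the rule the joint law of `(U, Λ, V)` is invariant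
under `V ↦ Qᵀ V` with `U` and `Λ` fixed (`IsRotationEquivariantSVD.map_bind`). Such an invariance
forces `V` to be isotropic and independent of `(U, Λ)`: compare `V` with `V'ᵀ V` for an independent
copy `V'` of `V` (`measure_inter_eq_mul_of_leftInvariant`). The law of `V` thus plays the role of the
Haar measure, and neither uniqueness nor unimodularity of the latter is used.

*Existence of rules.* It suffices to have some measurable choice of a decomposition, without any
equivariance: draw `Q` from the Haar measure of the orthogonal group, let `(U, Λ, W)` be the
decomposition chosen for `O Q`, and return `(U, Λ, Q W)`; equivariance is left invariance of the Haar
measure (`exists_isRotationEquivariantSVD`). A measurable choice exists because, after rescaling, the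
decompositions form a compact set which `(U, Λ, V) ↦ U Λ Vᵀ` maps continuously, and a continuous map
on a compact metrizable space has a Borel section onto its image
(`exists_measurable_section_of_isCompact`).
-/

/-! ### Borel sections of continuous maps on compact sets -/

/-- A continuous map has a Borel section over the image of a nonempty compact metrizable set. -/
theorem exists_measurable_section_of_isCompact {X Z : Type*} [TopologicalSpace X] [T2Space X]
    [MeasurableSpace X] [BorelSpace X] [TopologicalSpace Z] [TopologicalSpace.MetrizableSpace Z]
    [MeasurableSpace Z] [BorelSpace Z] {K : Set Z} (hK : IsCompact K) (hne : K.Nonempty)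
    {f : Z → X} (hf : Continuous f) :
    ∃ s : X → Z, Measurable s ∧ ∀ x ∈ f '' K, s x ∈ K ∧ f (s x) = x := by
  classical
  let _ : MetricSpace Z := TopologicalSpace.metrizableSpaceMetric Z
  have : CompactSpace K := isCompact_iff_compactSpace.mp hK
  have : Nonempty K := hne.to_subtype
  have : CompactSpace cantorSet := isCompact_iff_compactSpace.mp isCompact_cantorSet
  -- `K` is a continuous image of the Cantor set. As the latter is a compact subset of the line,
  -- every nonempty fibre of the composite `F` has a least point.
  obtain ⟨g₀, hg₀, hgs₀⟩ := exists_nat_bool_continuous_surjective_of_compact K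
  obtain ⟨g, hg, hgs⟩ : ∃ g : cantorSet → K, Continuous g ∧ Function.Surjective g :=
    ⟨g₀ ∘ cantorSetHomeomorphNatToBool, hg₀.comp cantorSetHomeomorphNatToBool.continuous,
      hgs₀.comp cantorSetHomeomorphNatToBool.surjective⟩
  set F : cantorSet → X := fun k => f (g k) with hF
  have hFc : Continuous F := hf.comp (continuous_subtype_val.comp hg)
  have hleast : ∀ x, x ∈ Set.range F → ∃ k, IsLeast {k | F k = x} k := fun x hx =>
    (isClosed_singleton.preimage hFc).isCompact.exists_isLeast hx
  -- The value off the range of `F` is irrelevant.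
  let k₀ : cantorSet := ⟨0, zero_mem_cantorSet⟩
  let σ : X → cantorSet := fun x => if h : x ∈ Set.range F then (hleast x h).choose else k₀
  have hσ : ∀ x ∈ Set.range F, IsLeast {k | F k = x} (σ x) := fun x hx => by
    simp only [σ, dif_pos hx]
    exact (hleast x hx).choose_spec
  have hσ' : ∀ x, x ∉ Set.range F → σ x = k₀ := fun x hx => by simp only [σ, dif_neg hx]
  have hrange : MeasurableSet (Set.range F) := (isCompact_range hFc).measurableSet
  have hmeas : Measurable σ := by
    have hemb : MeasurableEmbedding ((↑) : cantorSet → ℝ) :=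
      MeasurableEmbedding.subtype_coe isCompact_cantorSet.measurableSet
    refine hemb.measurable_comp_iff.mp (measurable_of_Iic fun c => ?_)
    have hc : IsCompact {k : cantorSet | (k : ℝ) ≤ c} :=
      (isClosed_Iic.preimage continuous_subtype_val).isCompact
    have hm : MeasurableSet (F '' {k : cantorSet | (k : ℝ) ≤ c}) :=
      (hc.image hFc).measurableSet
    -- On `range F`, the least point of the fibre over `x` is at most `c` iff `x` is the image of a
    -- point that is at most `c`; such `x` form a compact set.
    have heq : (((↑) : cantorSet → ℝ) ∘ σ) ⁻¹' Set.Iic c =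
        F '' {k : cantorSet | (k : ℝ) ≤ c} ∪ ((Set.range F)ᶜ ∩ {_x | (k₀ : ℝ) ≤ c}) := by
      ext x
      by_cases hx : x ∈ Set.range F
      · simp only [Set.mem_preimage, Set.mem_Iic, Set.mem_union, Set.mem_image, Set.mem_ofPred_eq,
          Set.mem_inter_iff, Set.mem_compl_iff, hx, not_true_eq_false, false_and, or_false]
        constructor
        · exact fun h => ⟨σ x, h, (hσ x hx).1⟩
        · rintro ⟨k, hk, hkx⟩
          exact le_trans ((hσ x hx).2 hkx) hk
      · have : x ∉ F '' {k : cantorSet | (k : ℝ) ≤ c} := fun h => hx (Set.image_subset_range _ _ h)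
        simp [hx, this, hσ' x hx]
    rw [heq]
    exact hm.union (hrange.compl.inter (MeasurableSet.const _))
  refine ⟨fun x => g (σ x), ?_, ?_⟩
  · exact (continuous_subtype_val.comp hg).measurable.comp hmeas
  · rintro x ⟨z, hz, rfl⟩
    obtain ⟨k, hk⟩ := hgs ⟨z, hz⟩
    have hx : f z ∈ Set.range F := ⟨k, by simp [hF, hk]⟩
    exact ⟨(g _).2, (hσ _ hx).1⟩

/-! ### Topology and measurability of real matrices -/

instance instBorelSpaceRealMatrix {m n : ℕ} : BorelSpace (Matrix (Fin m) (Fin n) ℝ) :=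
  inferInstanceAs (BorelSpace (Fin m → Fin n → ℝ))

instance instMetrizableSpaceRealMatrix {m n : ℕ} :
    TopologicalSpace.MetrizableSpace (Matrix (Fin m) (Fin n) ℝ) :=
  inferInstanceAs (TopologicalSpace.MetrizableSpace (Fin m → Fin n → ℝ))

instance instSecondCountableTopologyRealMatrix {m n : ℕ} :
    SecondCountableTopology (Matrix (Fin m) (Fin n) ℝ) :=
  inferInstanceAs (SecondCountableTopology (Fin m → Fin n → ℝ))

theorem measurable_const_matrix_mul {m n k : ℕ} (Q : Matrix (Fin m) (Fin n) ℝ) :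
    Measurable fun X : Matrix (Fin n) (Fin k) ℝ => Q * X :=
  Continuous.measurable (by fun_prop)

theorem measurable_matrix_mul_const {m n k : ℕ} (Q : Matrix (Fin n) (Fin k) ℝ) :
    Measurable fun X : Matrix (Fin m) (Fin n) ℝ => X * Q :=
  Continuous.measurable (by fun_prop)

theorem measurable_matrix_transpose {m n : ℕ} :
    Measurable fun X : Matrix (Fin m) (Fin n) ℝ => Xᵀ :=
  Continuous.measurable (by fun_prop)

/-! ### Orthogonal matrices -/

theorem abs_apply_le_one_of_mem_stiefel {n k : ℕ} {U : Matrix (Fin n) (Fin k) ℝ}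
    (hU : U ∈ stiefel n k) (i : Fin n) (j : Fin k) : |U i j| ≤ 1 := by
  have h : ∑ l, U l j * U l j = 1 := by
    have := congrFun (congrFun hU j) j
    simpa [Matrix.mul_apply] using this
  have h1 : U i j * U i j ≤ 1 :=
    h ▸ Finset.single_le_sum (fun l _ => mul_self_nonneg (U l j)) (Finset.mem_univ i)
  exact abs_le_one_iff_mul_self_le_one.mpr h1

theorem isClosed_stiefel {n k : ℕ} : IsClosed (stiefel n k) :=
  isClosed_eq (by fun_prop) continuous_const

theorem isCompact_setOf_abs_apply_le_one {m n : ℕ} :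
    IsCompact {X : Matrix (Fin m) (Fin n) ℝ | ∀ i j, |X i j| ≤ 1} := by
  have h : {X : Fin m → Fin n → ℝ | ∀ i j, |X i j| ≤ 1} =
      Set.univ.pi fun _ => Set.univ.pi fun _ => Set.Icc (-1 : ℝ) 1 := by
    ext X
    simp only [Set.mem_ofPred_eq, abs_le, Set.mem_pi, Set.mem_univ, true_imp_iff, Set.mem_Icc]
  have hc : IsCompact {X : Fin m → Fin n → ℝ | ∀ i j, |X i j| ≤ 1} :=
    h ▸ isCompact_univ_pi fun _ => isCompact_univ_pi fun _ => isCompact_Icc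
  exact hc

theorem isCompact_stiefel {n k : ℕ} : IsCompact (stiefel n k) :=
  isCompact_setOf_abs_apply_le_one.of_isClosed_subset isClosed_stiefel
    fun _ hU => abs_apply_le_one_of_mem_stiefel hU

theorem one_mem_stiefel {n : ℕ} : (1 : Matrix (Fin n) (Fin n) ℝ) ∈ stiefel n n := by
  simp [stiefel]

theorem transpose_mem_stiefel {n : ℕ} {U : Matrix (Fin n) (Fin n) ℝ} (hU : U ∈ stiefel n n) :
    Uᵀ ∈ stiefel n n := by
  simpa [stiefel] using mul_eq_one_comm.mp (hU : Uᵀ * U = 1)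

theorem mul_mem_stiefel {n k : ℕ} {U : Matrix (Fin n) (Fin n) ℝ} {V : Matrix (Fin n) (Fin k) ℝ}
    (hU : U ∈ stiefel n n) (hV : V ∈ stiefel n k) : U * V ∈ stiefel n k := by
  have hU' : Uᵀ * U = 1 := hU
  change (U * V)ᵀ * (U * V) = 1
  rw [Matrix.transpose_mul, Matrix.mul_assoc, ← Matrix.mul_assoc Uᵀ, hU', Matrix.one_mul]
  exact hV

/-! ### Singular value decompositions -/

theorem of_orthonormalBasis_mem_stiefel {n : ℕ}
    (b : OrthonormalBasis (Fin n) ℝ (EuclideanSpace ℝ (Fin n))) :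
    (Matrix.of fun i j => b j i) ∈ stiefel n n := by
  ext i j
  have h := orthonormal_iff_ite.mp b.orthonormal i j
  rw [PiLp.inner_apply] at h
  simpa [Matrix.mul_apply, Matrix.one_apply, mul_comm] using h

/-- The singular value decomposition of a linear map: `v` consists of eigenvectors of `Tᵀ T`, and
`u` extends the orthonormal family of the normalized nonzero images `T (v j)`. -/
theorem exists_orthonormalBasis_singularValues {p n : ℕ}
    (T : EuclideanSpace ℝ (Fin n) →ₗ[ℝ] EuclideanSpace ℝ (Fin p)) :
    ∃ (u : OrthonormalBasis (Fin p) ℝ (EuclideanSpace ℝ (Fin p)))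
      (v : OrthonormalBasis (Fin n) ℝ (EuclideanSpace ℝ (Fin n))),
      ∀ j : Fin n, T (v j) =
        if h : (j : ℕ) < p then T.singularValues j • u ⟨j, h⟩ else 0 := by
  have hn : Module.finrank ℝ (EuclideanSpace ℝ (Fin n)) = n := finrank_euclideanSpace_fin
  let v := T.isSymmetric_adjoint_comp_self.eigenvectorBasis hn
  have hinner (i j : Fin n) :
      inner ℝ (T (v i)) (T (v j)) = if i = j then T.singularValues i ^ 2 else 0 := by
    rw [← LinearMap.adjoint_inner_left, ← LinearMap.comp_apply,
      LinearMap.IsSymmetric.apply_eigenvectorBasis, inner_smul_left,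
      orthonormal_iff_ite.mp v.orthonormal i j, T.sq_singularValues_fin hn]
    simp
  have hzero (j : Fin n) (hj : T.singularValues j = 0) : T (v j) = 0 := by
    have := hinner j j
    simpa [hj] using this
  -- The rank of `T` is at most `p`, and so all nonzero singular values have an index below `p`.
  have hlt (j : ℕ) (hj : T.singularValues j ≠ 0) : j < p := by
    have h1 : j < Module.finrank ℝ T.range :=
      T.singularValues_pos_iff_lt_finrank_range.mp ((T.singularValues_pos_iff_ne_zero j).mpr hj)
    have h2 := Submodule.finrank_le T.range
    rw [finrank_euclideanSpace_fin] at h2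
    omega
  let w : Fin p → EuclideanSpace ℝ (Fin p) := fun i =>
    if h : (i : ℕ) < n then (T.singularValues i)⁻¹ • T (v ⟨i, h⟩) else 0
  let s : Set (Fin p) := {i | (i : ℕ) < n ∧ T.singularValues i ≠ 0}
  have hw : Orthonormal ℝ (s.domRestrict w) := by
    rw [orthonormal_iff_ite]
    rintro ⟨i, hi, hi'⟩ ⟨j, hj, hj'⟩
    have hij : ((⟨i, hi⟩ : Fin n) = ⟨j, hj⟩) ↔ i = j := by simp [Fin.ext_iff]
    simp only [Set.domRestrict_apply, w, dif_pos hi, dif_pos hj, inner_smul_left, inner_smul_right,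
      hinner, hij, Subtype.mk.injEq]
    split_ifs with h
    · subst h
      simp only [conj_trivial]
      field_simp
    · simp
  obtain ⟨u, hu⟩ := hw.exists_orthonormalBasis_extension_of_card_eq (by simp)
  refine ⟨u, v, fun j => ?_⟩
  by_cases hj : T.singularValues j = 0
  · simp [hj, hzero j hj]
  · have hjp := hlt j hj
    rw [dif_pos hjp, hu ⟨j, hjp⟩ ⟨j.2, hj⟩]
    simp [w, smul_smul, hj]

theorem exists_isSVD {p n : ℕ} (O : Matrix (Fin p) (Fin n) ℝ) : ∃ U Λ V, IsSVD O U Λ V := by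
  obtain ⟨u, v, h⟩ := exists_orthonormalBasis_singularValues (Matrix.toEuclideanLin O)
  set T := Matrix.toEuclideanLin O
  refine ⟨Matrix.of fun i j => u j i,
    Matrix.of fun i j => if (i : ℕ) = (j : ℕ) then T.singularValues j else 0,
    Matrix.of fun i j => v j i, ⟨of_orthonormalBasis_mem_stiefel u,
      of_orthonormalBasis_mem_stiefel v, ?_, ?_, ?_, ?_⟩⟩
  · intro i j hij
    simp [hij]
  · intro i j hij
    simpa [hij] using T.singularValues_nonneg _
  · intro i j i' j' hij hij' hle
    simpa [hij, hij'] using T.singularValues_antitone (by omega)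
  · have hV := mul_eq_one_comm.mp (of_orthonormalBasis_mem_stiefel v :
      (Matrix.of fun i j => v j i)ᵀ * (Matrix.of fun i j => v j i) = 1)
    have hOV : O * (Matrix.of fun i j => v j i) = (Matrix.of fun i j => u j i) *
        Matrix.of fun (i : Fin p) (j : Fin n) =>
          if (i : ℕ) = (j : ℕ) then T.singularValues j else 0 := by
      ext i j
      have hj : (O * (Matrix.of fun i j => v j i)) i j = T (v j) i := rfl
      rw [hj, h j, Matrix.mul_apply]
      split_ifs with hjp
      · rw [Finset.sum_eq_single ⟨j, hjp⟩]
        · simp [mul_comm]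
        · intro k _ hk
          have : (k : ℕ) ≠ j := fun h => hk (Fin.ext h)
          simp [this]
        · simp
      · symm
        refine Finset.sum_eq_zero fun k _ => ?_
        have : (k : ℕ) ≠ j := by omega
        simp [this]
    rw [← hOV, Matrix.mul_assoc, hV, Matrix.mul_one]

/-! ### Measurable singular value decompositions -/

/-- Bounds the singular values, so that all of them come to lie in `[0, 1]` after rescaling. -/
theorem IsSVD.abs_apply_le {p n : ℕ} {O : Matrix (Fin p) (Fin n) ℝ} {U Λ V}
    (h : IsSVD O U Λ V) (i : Fin p) (j : Fin n) : |Λ i j| ≤ ∑ k, ∑ l, |O k l| := by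
  have hΛ : Λ = Uᵀ * O * V := by
    have hU : Uᵀ * U = 1 := h.left_mem
    have hV : Vᵀ * V = 1 := h.right_mem
    rw [h.eq, Matrix.mul_assoc U, ← Matrix.mul_assoc Uᵀ, hU, Matrix.one_mul, Matrix.mul_assoc, hV,
      Matrix.mul_one]
  rw [hΛ, Matrix.mul_assoc, Matrix.mul_apply]
  refine (Finset.abs_sum_le_sum_abs _ _).trans (Finset.sum_le_sum fun k _ => ?_)
  rw [abs_mul, Matrix.mul_apply]
  have hVl (l : Fin n) : |O k l * V l j| ≤ |O k l| := by
    rw [abs_mul]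
    exact mul_le_of_le_one_right (abs_nonneg _) (abs_apply_le_one_of_mem_stiefel h.right_mem l j)
  calc |Uᵀ i k| * |∑ l, O k l * V l j| ≤ 1 * ∑ l, |O k l| := by
        gcongr
        · exact abs_apply_le_one_of_mem_stiefel h.left_mem k i
        · exact (Finset.abs_sum_le_sum_abs _ _).trans (Finset.sum_le_sum fun l _ => hVl l)
    _ = _ := one_mul _

theorem IsSVD.smul {p n : ℕ} {O : Matrix (Fin p) (Fin n) ℝ} {U Λ V} (h : IsSVD O U Λ V) {c : ℝ}
    (hc : 0 ≤ c) : IsSVD (c • O) U (c • Λ) V where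
  left_mem := h.left_mem
  right_mem := h.right_mem
  off_diag i j hij := by simp [h.off_diag i j hij]
  diag_nonneg i j hij := mul_nonneg hc (h.diag_nonneg i j hij)
  diag_antitone i j i' j' hij hij' hle :=
    mul_le_mul_of_nonneg_left (h.diag_antitone i j i' j' hij hij' hle) hc
  eq := by simp [h.eq]

/-- The rectangular diagonal `p × n` matrices with nonnegative, nonincreasing diagonal entries. -/
def sortedDiagonal (p n : ℕ) : Set (Matrix (Fin p) (Fin n) ℝ) :=
  {Λ | (∀ (i : Fin p) (j : Fin n), (i : ℕ) ≠ (j : ℕ) → Λ i j = 0) ∧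
    (∀ (i : Fin p) (j : Fin n), (i : ℕ) = (j : ℕ) → 0 ≤ Λ i j) ∧
    ∀ (i : Fin p) (j : Fin n) (i' : Fin p) (j' : Fin n),
      (i : ℕ) = (j : ℕ) → (i' : ℕ) = (j' : ℕ) → i ≤ i' → Λ i' j' ≤ Λ i j}

theorem isClosed_sortedDiagonal {p n : ℕ} : IsClosed (sortedDiagonal p n) := by
  have happ (i : Fin p) (j : Fin n) : Continuous fun Λ : Matrix (Fin p) (Fin n) ℝ => Λ i j := by
    fun_prop
  simp only [sortedDiagonal, Set.ofPred_forall, Set.ofPred_and]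
  refine .inter ?_ (.inter ?_ ?_)
  · exact isClosed_iInter fun i => isClosed_iInter fun j => isClosed_iInter fun _ =>
      isClosed_eq (happ i j) continuous_const
  · exact isClosed_iInter fun i => isClosed_iInter fun j => isClosed_iInter fun _ =>
      isClosed_le continuous_const (happ i j)
  · exact isClosed_iInter fun i => isClosed_iInter fun j => isClosed_iInter fun i' =>
      isClosed_iInter fun j' => isClosed_iInter fun _ => isClosed_iInter fun _ =>
      isClosed_iInter fun _ => isClosed_le (happ i' j') (happ i j)

theorem isSVD_iff {p n : ℕ} {O : Matrix (Fin p) (Fin n) ℝ} {U Λ V} :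
    IsSVD O U Λ V ↔
      U ∈ stiefel p p ∧ Λ ∈ sortedDiagonal p n ∧ V ∈ stiefel n n ∧ O = U * Λ * Vᵀ :=
  ⟨fun h => ⟨h.left_mem, ⟨h.off_diag, h.diag_nonneg, h.diag_antitone⟩, h.right_mem, h.eq⟩,
    fun ⟨hU, hΛ, hV, h⟩ => ⟨hU, hV, hΛ.1, hΛ.2.1, hΛ.2.2, h⟩⟩

theorem isClosed_setOf_isSVD {p n : ℕ} (O : Matrix (Fin p) (Fin n) ℝ) :
    IsClosed {s : Matrix (Fin p) (Fin p) ℝ × Matrix (Fin p) (Fin n) ℝ × Matrix (Fin n) (Fin n) ℝ |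
      IsSVD O s.1 s.2.1 s.2.2} := by
  simp only [isSVD_iff, Set.ofPred_and]
  exact (isClosed_stiefel.preimage continuous_fst).inter
    ((isClosed_sortedDiagonal.preimage continuous_snd.fst).inter
      ((isClosed_stiefel.preimage continuous_snd.snd).inter
        (isClosed_eq continuous_const (by fun_prop))))

/-- A singular value decomposition can be chosen in a Borel measurable way. -/
theorem exists_measurable_svd (p n : ℕ) :
    ∃ s : Matrix (Fin p) (Fin n) ℝ →
        Matrix (Fin p) (Fin p) ℝ × Matrix (Fin p) (Fin n) ℝ × Matrix (Fin n) (Fin n) ℝ,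
      Measurable s ∧ ∀ O, IsSVD O (s O).1 (s O).2.1 (s O).2.2 := by
  let f : Matrix (Fin p) (Fin p) ℝ × Matrix (Fin p) (Fin n) ℝ × Matrix (Fin n) (Fin n) ℝ →
      Matrix (Fin p) (Fin n) ℝ := fun x => x.1 * x.2.1 * x.2.2ᵀ
  have hf : Continuous f := by fun_prop
  let D : Set (Matrix (Fin p) (Fin n) ℝ) := {Λ | ∀ i j, |Λ i j| ≤ 1} ∩ sortedDiagonal p n
  have hD : IsCompact D := isCompact_setOf_abs_apply_le_one.inter_right isClosed_sortedDiagonal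
  have hK : IsCompact (stiefel p p ×ˢ D ×ˢ stiefel n n) :=
    isCompact_stiefel.prod (hD.prod isCompact_stiefel)
  have hne : (stiefel p p ×ˢ D ×ˢ stiefel n n).Nonempty :=
    ⟨(1, 0, 1), one_mem_stiefel, by simp [D, sortedDiagonal], one_mem_stiefel⟩
  obtain ⟨s, hs, hsf⟩ := exists_measurable_section_of_isCompact hK hne hf
  -- The section covers the matrices whose singular values are at most `1`; dividing by `c O` brings
  -- every matrix `O` there.
  let c : Matrix (Fin p) (Fin n) ℝ → ℝ := fun O => 1 + ∑ k, ∑ l, |O k l|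
  have hcpos (O) : 0 < c O := by positivity
  have hc : Continuous c := by fun_prop
  let r : Matrix (Fin p) (Fin n) ℝ → Matrix (Fin p) (Fin n) ℝ := fun O => (c O)⁻¹ • O
  have hr : Measurable r :=
    (Continuous.smul (hc.inv₀ fun O => (hcpos O).ne') continuous_id).measurable
  refine ⟨fun O => ((s (r O)).1, c O • (s (r O)).2.1, (s (r O)).2.2), ?_, fun O => ?_⟩
  · have hsr := hs.comp hr
    have hsmul : Measurable fun x : ℝ × Matrix (Fin p) (Fin n) ℝ => x.1 • x.2 :=
      continuous_smul.measurable
    exact hsr.fst.prodMk ((hsmul.comp (hc.measurable.prodMk hsr.snd.fst)).prodMk hsr.snd.snd)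
  · obtain ⟨U, Λ, V, h⟩ := exists_isSVD O
    have hmem : r O ∈ f '' (stiefel p p ×ˢ D ×ˢ stiefel n n) := by
      obtain ⟨hU, hΛ, hV, heq⟩ := isSVD_iff.mp (h.smul (inv_nonneg.mpr (hcpos O).le))
      refine ⟨(U, (c O)⁻¹ • Λ, V), ⟨hU, ⟨fun i j => ?_, hΛ⟩, hV⟩, heq.symm⟩
      change |(c O)⁻¹ * Λ i j| ≤ 1
      rw [abs_mul, abs_of_pos (inv_pos.mpr (hcpos O)), inv_mul_le_one₀ (hcpos O)]
      have := h.abs_apply_le i j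
      simp only [c]
      linarith
    obtain ⟨⟨hU, ⟨-, hΛ⟩, hV⟩, heq⟩ := hsf _ hmem
    have hsvd : IsSVD (r O) (s (r O)).1 (s (r O)).2.1 (s (r O)).2.2 :=
      isSVD_iff.mpr ⟨hU, hΛ, hV, heq.symm⟩
    have hO := hsvd.smul (hcpos O).le
    have hrO : c O • r O = O := by simp [r, smul_smul, (hcpos O).ne']
    rwa [hrO] at hO

/-! ### Existence of rotation-equivariant rules -/

/-- The image in the space of matrices of the Haar probability measure of the orthogonal group. -/
theorem exists_leftInvariant_probabilityMeasure_stiefel (n : ℕ) :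
    ∃ H : Measure (Matrix (Fin n) (Fin n) ℝ), IsProbabilityMeasure H ∧
      (∀ᵐ Q ∂H, Q ∈ stiefel n n) ∧ ∀ Q ∈ stiefel n n, H.map (fun X => Q * X) = H := by
  let G := Matrix.orthogonalGroup (Fin n) ℝ
  have hG (Q : Matrix (Fin n) (Fin n) ℝ) : Q ∈ G ↔ Q ∈ stiefel n n := by
    simp [G, Matrix.mem_orthogonalGroup_iff', stiefel]
  have : CompactSpace G := by
    refine isCompact_iff_compactSpace.mp ?_
    convert! isCompact_stiefel (n := n) (k := n) using 1
    ext Q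
    exact hG Q
  let _ : MeasurableSpace G := borel G
  have : BorelSpace G := ⟨rfl⟩
  let μ : Measure G := Measure.haarMeasure ⊤
  have hμ : IsProbabilityMeasure μ := ⟨by
    simpa using Measure.haarMeasure_self (K₀ := (⊤ : TopologicalSpace.PositiveCompacts G))⟩
  have hval : Measurable ((↑) : G → Matrix (Fin n) (Fin n) ℝ) := continuous_subtype_val.measurable
  refine ⟨μ.map (↑), Measure.isProbabilityMeasure_map hval.aemeasurable, ?_, fun Q hQ => ?_⟩
  · refine (ae_map_iff (p := (· ∈ stiefel n n)) hval.aemeasurable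
      isClosed_stiefel.measurableSet).mpr ?_
    exact .of_forall fun Q => (hG Q).mp Q.2
  · have hmul : Measurable fun X : Matrix (Fin n) (Fin n) ℝ => Q * X :=
      Continuous.measurable (by fun_prop)
    let g : G := ⟨Q, (hG Q).mpr hQ⟩
    have hg : Measurable fun x : G => g * x := (continuous_const_mul g).measurable
    conv_rhs => rw [← map_mul_left_eq_self μ g]
    rw [Measure.map_map hmul hval, Measure.map_map hval hg]
    rfl

theorem exists_isRotationEquivariantSVD (p n : ℕ) :
    ∃ κ : Kernel (Matrix (Fin p) (Fin n) ℝ)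
      (Matrix (Fin p) (Fin p) ℝ × Matrix (Fin p) (Fin n) ℝ × Matrix (Fin n) (Fin n) ℝ),
      IsRotationEquivariantSVD κ := by
  obtain ⟨s, hs, hsvd⟩ := exists_measurable_svd p n
  obtain ⟨H, hH, hHmem, hHinv⟩ := exists_leftInvariant_probabilityMeasure_stiefel n
  -- For `Q` distributed by the Haar measure, decompose `O * Q = U * Λ * Wᵀ` measurably and return
  -- `(U, Λ, Q * W)`.
  let Φ : Matrix (Fin p) (Fin n) ℝ × Matrix (Fin n) (Fin n) ℝ →
      Matrix (Fin p) (Fin p) ℝ × Matrix (Fin p) (Fin n) ℝ × Matrix (Fin n) (Fin n) ℝ :=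
    fun x => ((s (x.1 * x.2)).1, (s (x.1 * x.2)).2.1, x.2 * (s (x.1 * x.2)).2.2)
  have hmul : Measurable fun x : Matrix (Fin p) (Fin n) ℝ × Matrix (Fin n) (Fin n) ℝ =>
      x.1 * x.2 := Continuous.measurable (by fun_prop)
  have hmul' : Measurable fun x : Matrix (Fin n) (Fin n) ℝ × Matrix (Fin n) (Fin n) ℝ =>
      x.1 * x.2 := Continuous.measurable (by fun_prop)
  have hΦ : Measurable Φ := by
    have h := hs.comp hmul
    exact h.fst.prodMk (h.snd.fst.prodMk (hmul'.comp (measurable_snd.prodMk h.snd.snd)))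
  have hΦO (O) : Measurable fun Q => Φ (O, Q) := hΦ.comp measurable_prodMk_left
  refine ⟨⟨fun O => H.map fun Q => Φ (O, Q), ?_⟩, ?_, ?_, ?_⟩
  · refine Measure.measurable_of_measurable_coe _ fun S hS => ?_
    simp_rw [Measure.map_apply (hΦO _) hS]
    exact measurable_measure_prodMk_left (hΦ hS)
  · exact ⟨fun O => Measure.isProbabilityMeasure_map (hΦO O).aemeasurable⟩
  · intro O
    refine (ae_map_iff (hΦO O).aemeasurable (isClosed_setOf_isSVD O).measurableSet).mpr ?_
    filter_upwards [hHmem] with Q hQ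
    have hQ' : Q * Qᵀ = 1 := mul_eq_one_comm.mp hQ
    have h := hsvd (O * Q)
    refine ⟨h.left_mem, mul_mem_stiefel hQ h.right_mem, h.off_diag, h.diag_nonneg,
      h.diag_antitone, ?_⟩
    simp only [Φ, Matrix.transpose_mul]
    rw [← Matrix.mul_assoc, ← h.eq, Matrix.mul_assoc, hQ', Matrix.mul_one]
  · intro O R hR
    -- With `Q' = R * Q`, again Haar distributed, `O * R * Q = O * Q'` and `Q = Rᵀ * Q'`.
    have hRm : Measurable fun X : Matrix (Fin n) (Fin n) ℝ => R * X :=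
      Continuous.measurable (by fun_prop)
    have hV : Measurable fun x : Matrix (Fin p) (Fin p) ℝ × Matrix (Fin p) (Fin n) ℝ ×
        Matrix (Fin n) (Fin n) ℝ => (x.1, x.2.1, Rᵀ * x.2.2) :=
      Continuous.measurable (by fun_prop)
    change H.map (fun Q => Φ (O * R, Q)) = (H.map fun Q => Φ (O, Q)).map _
    conv_rhs => rw [← hHinv R hR]
    rw [Measure.map_map (hΦO O) hRm, Measure.map_map hV ((hΦO O).comp hRm)]
    congr 1
    ext1 Q
    have hR' : Rᵀ * R = 1 := hR
    simp [Φ, Matrix.mul_assoc, ← Matrix.mul_assoc Rᵀ R, hR']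

/-! ### Left-invariant random orthogonal matrices -/

section LeftInvariant

variable {Ω E : Type*} [MeasurableSpace Ω] [MeasurableSpace E] {P : Measure Ω}
  [IsProbabilityMeasure P] {n : ℕ} {W : Ω → E} {V : Ω → Matrix (Fin n) (Fin n) ℝ}

/-- If the joint law of `W` and the random orthogonal matrix `V` is invariant under left
multiplication of `V`, then the events `W ∈ B` and `V ∈ S` factorize, with the law of `Vᵀ` in place
of that of `V`. Indeed, for an independent copy `(W', V')`, the probability of `W ∈ B` and
`V'ᵀ * V ∈ S` can be computed in two ways: given `V'`, the matrix `V'ᵀ * V` is jointly with `W`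
distributed as `V`; given `(W, V)`, the matrix `V'ᵀ * V = (Vᵀ * V')ᵀ` is distributed as `V'ᵀ`. -/
theorem measure_inter_eq_mul_of_leftInvariant (hW : Measurable W) (hV : Measurable V)
    (hVmem : ∀ᵐ ω ∂P, V ω ∈ stiefel n n)
    (hinv : ∀ Q ∈ stiefel n n,
      P.map (fun ω => (W ω, Q * V ω)) = P.map (fun ω => (W ω, V ω)))
    {B : Set E} (hB : MeasurableSet B) {S : Set (Matrix (Fin n) (Fin n) ℝ)}
    (hS : MeasurableSet S) :
    P (W ⁻¹' B ∩ V ⁻¹' S) = P (W ⁻¹' B) * P {ω | (V ω)ᵀ ∈ S} := by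
  have hmeas (Q : Matrix (Fin n) (Fin n) ℝ) : Measurable fun ω => (W ω, Q * V ω) :=
    hW.prodMk ((measurable_const_matrix_mul Q).comp hV)
  have hpair (ω' : Ω) (hω' : V ω' ∈ stiefel n n) :
      P {ω | W ω ∈ B ∧ (V ω')ᵀ * V ω ∈ S} = P (W ⁻¹' B ∩ V ⁻¹' S) := by
    have h := congrArg (fun μ => μ (B ×ˢ S)) (hinv _ (transpose_mem_stiefel hω'))
    rwa [Measure.map_apply (hmeas _) (hB.prod hS),
      Measure.map_apply (hW.prodMk hV) (hB.prod hS)] at h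
  have hpair' (ω : Ω) (hω : V ω ∈ stiefel n n) :
      P {ω' | (V ω')ᵀ * V ω ∈ S} = P {ω' | (V ω')ᵀ ∈ S} := by
    have h := congrArg (fun μ => μ (Prod.snd ⁻¹' (Matrix.transpose ⁻¹' S)))
      (hinv _ (transpose_mem_stiefel hω))
    have hS' : MeasurableSet
        (Prod.snd ⁻¹' (Matrix.transpose ⁻¹' S) : Set (E × Matrix (Fin n) (Fin n) ℝ)) :=
      measurable_snd (measurable_matrix_transpose hS)
    rw [Measure.map_apply (hmeas _) hS',
      Measure.map_apply (hW.prodMk hV) hS'] at h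
    simpa [Set.preimage, Matrix.transpose_mul] using h
  have hmul : Measurable fun x : Ω × Ω => (V x.1)ᵀ * V x.2 := by
    have hc : Measurable fun x : Matrix (Fin n) (Fin n) ℝ × Matrix (Fin n) (Fin n) ℝ =>
        x.1ᵀ * x.2 := Continuous.measurable (by fun_prop)
    exact hc.comp ((hV.comp measurable_fst).prodMk (hV.comp measurable_snd))
  let T : Set (Ω × Ω) := {x | W x.2 ∈ B ∧ (V x.1)ᵀ * V x.2 ∈ S}
  have hT : MeasurableSet T := (hB.preimage (hW.comp measurable_snd)).inter (hmul hS)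
  calc P (W ⁻¹' B ∩ V ⁻¹' S) = ∫⁻ ω', P (Prod.mk ω' ⁻¹' T) ∂P := by
        have h : ∫⁻ ω', P (Prod.mk ω' ⁻¹' T) ∂P = ∫⁻ _, P (W ⁻¹' B ∩ V ⁻¹' S) ∂P :=
          lintegral_congr_ae (hVmem.mono fun ω' hω' => hpair ω' hω')
        simp [h]
    _ = (P.prod P) T := (Measure.prod_apply hT).symm
    _ = ∫⁻ ω, P ((fun ω' => (ω', ω)) ⁻¹' T) ∂P := Measure.prod_apply_symm hT
    _ = ∫⁻ ω, (W ⁻¹' B).indicator (fun _ => P {ω | (V ω)ᵀ ∈ S}) ω ∂P := by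
        refine lintegral_congr_ae (hVmem.mono fun ω hω => ?_)
        by_cases hωB : W ω ∈ B
        · simpa [T, hωB] using hpair' ω hω
        · simp [T, hωB]
    _ = P (W ⁻¹' B) * P {ω | (V ω)ᵀ ∈ S} := by
        rw [lintegral_indicator_const (hW hB), mul_comm]

/-- A random orthogonal matrix whose joint law with `W` is invariant under left multiplication is
isotropic and independent of `W`. -/
theorem isIsotropic_and_indepFun_of_leftInvariant (hW : Measurable W) (hV : Measurable V)
    (hVmem : ∀ᵐ ω ∂P, V ω ∈ stiefel n n)
    (hinv : ∀ Q ∈ stiefel n n,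
      P.map (fun ω => (W ω, Q * V ω)) = P.map (fun ω => (W ω, V ω))) :
    IsIsotropic (P.map V) ∧ IndepFun V W P := by
  have hkey := fun {B : Set E} (hB : MeasurableSet B) {S : Set (Matrix (Fin n) (Fin n) ℝ)}
    (hS : MeasurableSet S) => measure_inter_eq_mul_of_leftInvariant hW hV hVmem hinv hB hS
  -- The case `B = univ` says that `V` and `Vᵀ` have the same law.
  have htr {S : Set (Matrix (Fin n) (Fin n) ℝ)} (hS : MeasurableSet S) :
      P {ω | (V ω)ᵀ ∈ S} = P (V ⁻¹' S) := by
    simpa using (hkey .univ hS).symm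
  have hleft : ∀ Q ∈ stiefel n n, (P.map V).map (fun X => Q * X) = P.map V := by
    intro Q hQ
    have hmeas : Measurable fun ω => (W ω, Q * V ω) :=
      hW.prodMk ((measurable_const_matrix_mul Q).comp hV)
    have h := congrArg (fun μ => μ.map Prod.snd) (hinv Q hQ)
    rw [Measure.map_map measurable_snd hmeas, Measure.map_map measurable_snd (hW.prodMk hV)] at h
    rw [Measure.map_map (measurable_const_matrix_mul Q) hV]
    exact h
  have htrans : (P.map V).map Matrix.transpose = P.map V := by
    ext S hS
    rw [Measure.map_map measurable_matrix_transpose hV,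
      Measure.map_apply (measurable_matrix_transpose.comp hV) hS, Measure.map_apply hV hS]
    exact htr hS
  refine ⟨⟨Measure.isProbabilityMeasure_map hV.aemeasurable, ?_, hleft, fun Q hQ => ?_⟩, ?_⟩
  · exact (ae_map_iff (p := (· ∈ stiefel n n)) hV.aemeasurable
      isClosed_stiefel.measurableSet).mpr hVmem
  · -- Right translation by `Q` is left translation by `Qᵀ` conjugated by transposition.
    have hfun : (fun X : Matrix (Fin n) (Fin n) ℝ => X * Q) =
        Matrix.transpose ∘ (fun X => Qᵀ * X) ∘ Matrix.transpose := by
      ext1 X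
      simp
    rw [hfun, ← Measure.map_map measurable_matrix_transpose
      ((measurable_const_matrix_mul _).comp measurable_matrix_transpose),
      ← Measure.map_map (measurable_const_matrix_mul _) measurable_matrix_transpose, htrans,
      hleft _ (transpose_mem_stiefel hQ), htrans]
  · refine IndepFun.symm (indepFun_iff_measure_inter_preimage_eq_mul.mpr fun B S hB hS => ?_)
    rw [hkey hB hS, htr hS]

end LeftInvariant

/-! ### Invariance of the observation matrix -/

/-- A change of orthonormal coordinates in `ℝⁿ` multiplies the observation matrix on the right. -/
theorem observationMatrix_conj {n d m : ℕ} (A : Matrix (Fin n) (Fin n) ℝ)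
    (C : Matrix (Fin d) (Fin n) ℝ) (t : Fin m → ℕ) {Q : Matrix (Fin n) (Fin n) ℝ}
    (hQ : Q ∈ stiefel n n) :
    observationMatrix (Qᵀ * A * Q) (C * Q) t = observationMatrix A C t * Q := by
  have hQ' : Q * Qᵀ = 1 := mul_eq_one_comm.mp hQ
  have hQ1 : Qᵀ * Q = 1 := hQ
  have hpow (k : ℕ) : Q * (Qᵀ * A * Q) ^ k = A ^ k * Q := by
    induction k with
    | zero => simp
    | succ k ih =>
      rw [pow_succ, ← Matrix.mul_assoc, ih, pow_succ, Matrix.mul_assoc, Matrix.mul_assoc Qᵀ,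
        ← Matrix.mul_assoc Q, hQ', Matrix.one_mul, ← Matrix.mul_assoc]
  ext i j
  simp only [observationMatrix, Matrix.of_apply]
  rw [Matrix.mul_assoc, hpow, ← Matrix.mul_assoc]
  rfl

theorem continuous_observationMatrix {n d m : ℕ} (t : Fin m → ℕ) :
    Continuous fun x : Matrix (Fin n) (Fin n) ℝ × Matrix (Fin d) (Fin n) ℝ =>
      observationMatrix x.1 x.2 t := by
  refine continuous_matrix fun i j => ?_
  simp only [observationMatrix, Matrix.of_apply]
  exact Continuous.matrix_elem (by fun_prop) _ _

/-- The law of the observation matrix is invariant under right rotations. -/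
theorem map_observationMatrix_mul {n d m : ℕ} (t : Fin m → ℕ)
    {Ω : Type*} [MeasurableSpace Ω] {P : Measure Ω} [IsProbabilityMeasure P]
    {A : Ω → Matrix (Fin n) (Fin n) ℝ} {C : Ω → Matrix (Fin d) (Fin n) ℝ}
    (hA : Measurable A) (hC : Measurable C)
    (hAinv : IsRotationInvariant (P.map A)) (hCinv : IsRotationInvariant (P.map C))
    (hAC : IndepFun A C P) {Q : Matrix (Fin n) (Fin n) ℝ} (hQ : Q ∈ stiefel n n) :
    (P.map fun ω => observationMatrix (A ω) (C ω) t).map (fun O => O * Q) =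
      P.map fun ω => observationMatrix (A ω) (C ω) t := by
  have hobs := (continuous_observationMatrix (n := n) (d := d) t).measurable
  have hconj : Measurable fun X : Matrix (Fin n) (Fin n) ℝ => Qᵀ * X * Q :=
    (measurable_matrix_mul_const Q).comp (measurable_const_matrix_mul Qᵀ)
  have hconj' : Measurable fun ω => Qᵀ * A ω * Q := hconj.comp hA
  have hmulQ : Measurable fun ω => C ω * Q := (measurable_matrix_mul_const Q).comp hC
  have hobs' : Measurable fun ω => observationMatrix (A ω) (C ω) t := hobs.comp (hA.prodMk hC)
  have hconjA : P.map (fun ω => Qᵀ * A ω * Q) = P.map A := by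
    have h : (P.map A).map (fun X => Qᵀ * X * Q) = P.map A := by
      change (P.map A).map ((fun X => X * Q) ∘ fun X => Qᵀ * X) = P.map A
      rw [← Measure.map_map (measurable_matrix_mul_const Q) (measurable_const_matrix_mul Qᵀ),
        hAinv.1 _ (transpose_mem_stiefel hQ), hAinv.2 _ hQ]
    rwa [Measure.map_map hconj hA] at h
  have hmulC : P.map (fun ω => C ω * Q) = P.map C := by
    have h := hCinv.2 _ hQ
    rwa [Measure.map_map (measurable_matrix_mul_const Q) hC] at h
  have hlaw : P.map (fun ω => (Qᵀ * A ω * Q, C ω * Q)) = P.map fun ω => (A ω, C ω) := by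
    have hind : IndepFun (fun ω => Qᵀ * A ω * Q) (fun ω => C ω * Q) P :=
      hAC.comp hconj (measurable_matrix_mul_const Q)
    rw [(indepFun_iff_map_prod_eq_prod_map_map hconj'.aemeasurable
        hmulQ.aemeasurable).mp hind,
      (indepFun_iff_map_prod_eq_prod_map_map hA.aemeasurable hC.aemeasurable).mp hAC,
      hconjA, hmulC]
  rw [Measure.map_map (measurable_matrix_mul_const Q) hobs']
  calc P.map ((fun O => O * Q) ∘ fun ω => observationMatrix (A ω) (C ω) t)
      = P.map ((fun x : Matrix (Fin n) (Fin n) ℝ × Matrix (Fin d) (Fin n) ℝ =>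
          observationMatrix x.1 x.2 t) ∘ fun ω => (Qᵀ * A ω * Q, C ω * Q)) := by
        congr 1
        ext1 ω
        exact (observationMatrix_conj (A ω) (C ω) t hQ).symm
    _ = P.map ((fun x : Matrix (Fin n) (Fin n) ℝ × Matrix (Fin d) (Fin n) ℝ =>
          observationMatrix x.1 x.2 t) ∘ fun ω => (A ω, C ω)) := by
        rw [← Measure.map_map hobs (hconj'.prodMk hmulQ), hlaw,
          Measure.map_map hobs (hA.prodMk hC)]
    _ = _ := rfl

/-- For a right-invariant law of `O`, the law of the chosen decomposition is invariant under
rotations of `V` that keep `U` and `Λ` fixed. -/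
theorem IsRotationEquivariantSVD.map_bind {p n : ℕ}
    {κ : Kernel (Matrix (Fin p) (Fin n) ℝ)
      (Matrix (Fin p) (Fin p) ℝ × Matrix (Fin p) (Fin n) ℝ × Matrix (Fin n) (Fin n) ℝ)}
    (hκ : IsRotationEquivariantSVD κ) {ν : Measure (Matrix (Fin p) (Fin n) ℝ)}
    {Q : Matrix (Fin n) (Fin n) ℝ} (hQ : Q ∈ stiefel n n)
    (hν : ν.map (fun O => O * Q) = ν) :
    (ν.bind κ).map (fun s => (s.1, s.2.1, Qᵀ * s.2.2)) = ν.bind κ := by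
  have hmeas : Measurable fun s : Matrix (Fin p) (Fin p) ℝ × Matrix (Fin p) (Fin n) ℝ ×
      Matrix (Fin n) (Fin n) ℝ => (s.1, s.2.1, Qᵀ * s.2.2) :=
    Continuous.measurable (by fun_prop)
  ext S hS
  rw [Measure.map_apply hmeas hS, Measure.bind_apply (hmeas hS) κ.aemeasurable]
  conv_rhs => rw [← hν]
  rw [Measure.bind_apply hS κ.aemeasurable,
    lintegral_map (κ.measurable_coe hS) (measurable_matrix_mul_const Q)]
  refine lintegral_congr fun O => ?_
  rw [hκ.equivariant O Q hQ, Measure.map_apply hmeas hS]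

theorem mainTheorem7 {n d m : ℕ} (t : Fin m → ℕ)
    {Ω : Type*} [MeasurableSpace Ω] (P : Measure Ω) [IsProbabilityMeasure P]
    (A : Ω → Matrix (Fin n) (Fin n) ℝ) (C : Ω → Matrix (Fin d) (Fin n) ℝ)
    (hA : Measurable A) (hC : Measurable C)
    (hAinv : IsRotationInvariant (P.map A)) (hCinv : IsRotationInvariant (P.map C))
    (hAC : IndepFun A C P) :
    (∃ κ : Kernel (Matrix (Fin (m * d)) (Fin n) ℝ)
        (Matrix (Fin (m * d)) (Fin (m * d)) ℝ × Matrix (Fin (m * d)) (Fin n) ℝ ×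
          Matrix (Fin n) (Fin n) ℝ), IsRotationEquivariantSVD κ) ∧
    ∀ κ : Kernel (Matrix (Fin (m * d)) (Fin n) ℝ)
        (Matrix (Fin (m * d)) (Fin (m * d)) ℝ × Matrix (Fin (m * d)) (Fin n) ℝ ×
          Matrix (Fin n) (Fin n) ℝ),
      IsRotationEquivariantSVD κ →
      ∀ (U : Ω → Matrix (Fin (m * d)) (Fin (m * d)) ℝ)
        (Λ : Ω → Matrix (Fin (m * d)) (Fin n) ℝ) (V : Ω → Matrix (Fin n) (Fin n) ℝ),
        Measurable U → Measurable Λ → Measurable V →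
        HasCondDistrib (fun ω => (U ω, Λ ω, V ω)) (fun ω => observationMatrix (A ω) (C ω) t) κ P →
        IsIsotropic (P.map V) ∧ IndepFun V (fun ω => (U ω, Λ ω)) P := by
  refine ⟨exists_isRotationEquivariantSVD _ _, fun κ hκ U Λ V hU hΛ hV hcond => ?_⟩
  have := hκ.isMarkovKernel
  have hUΛV : Measurable fun ω => (U ω, Λ ω, V ω) := hU.prodMk (hΛ.prodMk hV)
  have hobs : Measurable fun ω => observationMatrix (A ω) (C ω) t :=
    (continuous_observationMatrix t).measurable.comp (hA.prodMk hC)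
  have : IsProbabilityMeasure (P.map fun ω => observationMatrix (A ω) (C ω) t) :=
    Measure.isProbabilityMeasure_map hobs.aemeasurable
  have hlaw : P.map (fun ω => (U ω, Λ ω, V ω)) =
      (P.map fun ω => observationMatrix (A ω) (C ω) t).bind κ := by
    have h := congrArg Measure.snd hcond.map_eq
    rwa [Measure.snd_map_prodMk hobs, Measure.snd_compProd] at h
  refine isIsotropic_and_indepFun_of_leftInvariant (hU.prodMk hΛ) hV ?_ fun Q hQ => ?_
  · have hae : ∀ᵐ s ∂P.map (fun ω => (U ω, Λ ω, V ω)), s.2.2 ∈ stiefel _ _ := by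
      rw [hlaw]
      exact Measure.ae_comp_of_ae_ae
        (measurable_snd.snd isClosed_stiefel.measurableSet)
        (.of_forall fun O => (hκ.ae_isSVD O).mono fun s hs => hs.right_mem)
    exact ae_of_ae_map hUΛV.aemeasurable hae
  · have h := hκ.map_bind (transpose_mem_stiefel hQ)
      (map_observationMatrix_mul t hA hC hAinv hCinv hAC (transpose_mem_stiefel hQ))
    have hmeas : Measurable fun s : Matrix (Fin (m * d)) (Fin (m * d)) ℝ ×
        Matrix (Fin (m * d)) (Fin n) ℝ × Matrix (Fin n) (Fin n) ℝ =>
        (s.1, s.2.1, Qᵀᵀ * s.2.2) := Continuous.measurable (by fun_prop)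
    have hassoc : Measurable fun s : Matrix (Fin (m * d)) (Fin (m * d)) ℝ ×
        Matrix (Fin (m * d)) (Fin n) ℝ × Matrix (Fin n) (Fin n) ℝ =>
        ((s.1, s.2.1), s.2.2) := by fun_prop
    rw [← hlaw, Measure.map_map hmeas hUΛV] at h
    have h' := congrArg (fun μ => μ.map fun s => ((s.1, s.2.1), s.2.2)) h
    rw [Measure.map_map hassoc (hmeas.comp hUΛV), Measure.map_map hassoc hUΛV] at h'
    simpa only [Function.comp_def, Matrix.transpose_transpose] using h'
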